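/- For integers $r\ge 0$ and $N\ge 0$ let $$d_r(N)=\det\left(\binom{2i+2j+r}{i+j}\right)_{i,j=0}^{N-1}$$ (so $d_r(0)=1$). Then for all integers $k\ge 0$ and $n\ge 0$ $$d_{2k+1}\bigl((2k+1)n+1\bigr)=(2n+1)^k,\qquad d_{2k}(2kn+1)=(-1)^{kn},$$ and for all integers $k\ge 1$ and $n\ge 0$ $$d_{2k}(2kn+k+1)=-(-1)^{kn+\binom{k}{2}}\,4^{k-1}\,k^{k-1}\,(n+1)^{k-1}.$$ -/

import Mathlib

/-- The Hankel determinant `d_r(N) = det (binom (2i+2j+r) (i+j))`, `0 ≤ i, j ≤ N - 1`, of the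
sequence `binom (2n+r) n`; for `N = 0` it is the empty determinant `1`. -/
def hankelDet (r N : ℕ) : ℤ :=
  Matrix.det (Matrix.of fun i j : Fin N =>
    ((Nat.choose (2 * (i : ℕ) + 2 * (j : ℕ) + r) ((i : ℕ) + (j : ℕ)) : ℕ) : ℤ))

/-! Let Λ be the functional on polynomials with moments binom(2n, n) (even r) or binom(2n+1, n) (odd
r). Its orthogonal polynomials p_m are Chebyshev polynomials in X = 4 cos²θ, `chebC` and `chebV`
respectively, and with W = C_k or V_k the value Λ(X^(n+k) W) is 2 binom(2n+2k, n) or binom(2n+2k+1,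
n). Up to powers of 2, the matrix is therefore the Hankel matrix of Λ twisted by X^k W.

A Christoffel-type formula (`det_functional_mul`) trades this N × N determinant for a 2k × 2k one,
built from p_N, ..., p_(N+2k-1) modulo X^k W (`det_functional_eq_modDivMatrix`).

For the special N, these 2k indices are, but for one, symmetric about a centre. Product-to-sum
formulas make the sum (`det_modDivMatrix_center_add`) or difference (`det_modDivMatrix_center_sub`)
of mirror-image polynomials divisible by W. The determinant then splits (`det_modDivMatrix`): k rows
are residues modulo W, equal up to scalars to p_0, ..., p_(k-1) because indices are antiperiodic
modulo W; the other k rows are cofactors whose coefficient matrix has a determinant given by values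
at X = 0. -/

open Polynomial in
/-- The matrix of the first coefficients of a family of polynomials. -/
def coeffMatrix {ι κ : Type*} (f : ι → ℤ[X]) (e : κ → ℕ) : Matrix ι κ ℤ :=
  Matrix.of fun a b => (f a).coeff (e b)

/-! ### Signs of cyclic shifts and of the reversal. -/

section Signs
open Equiv

theorem sign_finCycle_of_even {n : ℕ} (k : Fin n) (hk : Even (k : ℕ)) :
    Perm.sign (finCycle k) = 1 := by
  have h : finCycle k = (finRotate n) ^ (k : ℕ) := by
    ext1 i
    rw [finCycle_eq_finRotate_iterate, Perm.iterate_eq_pow]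
  rw [h, map_pow]
  obtain ⟨m, hm⟩ := hk
  rw [hm, pow_add, ← mul_pow, Int.units_mul_self, one_pow]

/-- Reversal followed by one rotation fixes 0 and reverses the remaining points, so each induction
step contributes the sign (-1)^n of the rotation. -/
theorem sign_revPerm (n : ℕ) : Perm.sign (Fin.revPerm : Perm (Fin n)) = (-1) ^ n.choose 2 := by
  induction n with
  | zero => rw [Subsingleton.elim (Fin.revPerm : Perm (Fin 0)) 1]; simp
  | succ n ih =>
    have h : finRotate (n + 1) * Fin.revPerm
        = Perm.decomposeFin.symm (0, (Fin.revPerm : Perm (Fin n))) := by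
      ext1 i
      refine Fin.cases ?_ (fun i => ?_) i
      · simp
      · simp [Fin.rev_succ]
    have h2 := congrArg Perm.sign h
    rw [map_mul, sign_finRotate, Perm.decomposeFin.symm_sign, ih] at h2
    rw [if_pos rfl, one_mul, Nat.succ_sub_one] at h2
    rw [Nat.choose_succ_succ' n 1, Nat.choose_one_right, pow_add, ← h2, ← mul_assoc, ← mul_pow]
    simp

end Signs

/-! ### Coefficient determinants and the Christoffel-type formula. -/

section Determinants
open Polynomial Matrix

/-- Exchanging the two row blocks amounts, after relabelling, to a cyclic shift of the columns by d,
which is an even permutation when d is even. -/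
theorem det_submatrix_finSum_swap {N d : ℕ} (hd : Even d) (M : Matrix (Fin N ⊕ Fin d) ℕ ℤ) :
    (M.submatrix id fun b => (finSumFinEquiv b : Fin (N + d)).val).det =
      (M.submatrix Sum.swap fun b => (finSumFinEquiv b : Fin (d + N)).val).det := by
  rcases Nat.eq_zero_or_pos N with rfl | hN
  · rw [← Matrix.det_submatrix_equiv_self (Equiv.sumComm (Fin 0) (Fin d)).symm]
    congr 1
    ext a b
    rcases b with b | b
    · simp only [Matrix.submatrix_apply, Equiv.sumComm_symm, Equiv.sumComm_apply, Sum.swap_inl,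
        finSumFinEquiv_apply_left, finSumFinEquiv_apply_right, Fin.val_natAdd, Fin.val_castAdd,
        zero_add, id_eq]
    · exact b.elim0
  · set B : Matrix (Fin (N + d)) (Fin (N + d)) ℤ :=
      (M.submatrix id fun b => (finSumFinEquiv b : Fin (N + d)).val).submatrix
        finSumFinEquiv.symm finSumFinEquiv.symm with hB
    have h1 : B.det = (M.submatrix id fun b => (finSumFinEquiv b : Fin (N + d)).val).det :=
      Matrix.det_submatrix_equiv_self _ _
    have h2 := Matrix.det_permute' (finCycle (⟨d, by omega⟩ : Fin (N + d))) B
    rw [sign_finCycle_of_even _ hd, h1] at h2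
    simp only [Units.val_one, Int.cast_one, one_mul] at h2
    rw [← h2, ← Matrix.det_submatrix_equiv_self (finSumFinEquiv (m := N) (n := d)),
      ← Matrix.det_submatrix_equiv_self (Equiv.sumComm (Fin N) (Fin d))
        (M.submatrix Sum.swap fun b => (finSumFinEquiv b : Fin (d + N)).val)]
    congr 1
    ext a b
    have key : ((finCycle (⟨d, by omega⟩ : Fin (N + d)) (finSumFinEquiv b)).val) =
        (finSumFinEquiv (Equiv.sumComm (Fin N) (Fin d) b) : Fin (d + N)).val := by
      rw [finCycle_apply, Fin.val_add]
      rcases b with b | b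
      · have := b.2
        simp only [finSumFinEquiv_apply_left, Fin.val_castAdd, Equiv.sumComm_apply,
          Sum.swap_inl, finSumFinEquiv_apply_right, Fin.val_natAdd]
        rw [Nat.mod_eq_of_lt (by omega)]; omega
      · have := b.2
        simp only [finSumFinEquiv_apply_left, Fin.val_castAdd, Equiv.sumComm_apply,
          Sum.swap_inr, finSumFinEquiv_apply_right, Fin.val_natAdd]
        rw [show N + b.val + d = b.val + (N + d) by omega, Nat.add_mod_right,
          Nat.mod_eq_of_lt (by omega)]
    simp only [hB, Matrix.submatrix_apply, id_eq, Equiv.symm_apply_apply, Equiv.apply_symm_apply,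
      Equiv.sumComm_apply, Sum.swap_swap]
    rw [key]
    rfl

theorem det_coeffMatrix_eq_one {n : ℕ} (p : ℕ → ℤ[X]) (hm : ∀ m, (p m).Monic)
    (hd : ∀ m, (p m).natDegree = m) :
    (coeffMatrix (fun i : Fin n => p i) (fun j : Fin n => (j : ℕ))).det = 1 := by
  rw [Matrix.det_of_isLowerTriangular]
  · refine Finset.prod_eq_one fun i _ => ?_
    have := (hm i).coeff_natDegree
    rwa [hd] at this
  · intro i j hij
    exact coeff_eq_zero_of_natDegree_lt (by rw [hd]; exact hij)

theorem eq_sum_of_degree_lt {f : ℤ[X]} {n : ℕ} (hf : f.degree < n) :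
    f = ∑ i : Fin n, C (f.coeff i) * X ^ (i : ℕ) := by
  rcases eq_or_ne f 0 with rfl | h0
  · simp
  · rw [← Finset.sum_range fun i => C (f.coeff i) * X ^ i]
    exact f.as_sum_range_C_mul_X_pow' ((natDegree_lt_iff_degree_lt h0).mpr hf)

/-- Change of basis from the monomials to 1, ..., X^(d-1), Q, XQ, ..., X^(n-1)Q. It is
unitriangular, and coordinates in the new basis are the coefficients of remainder and quotient. -/
theorem det_coeffMatrix_eq_mod_div {d n : ℕ} (Q : ℤ[X]) (hQ : Q.Monic) (hQd : Q.natDegree = d)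
    (f : Fin d ⊕ Fin n → ℤ[X]) (hf : ∀ a, (f a).degree < (d + n : ℕ)) :
    (coeffMatrix f fun b => (finSumFinEquiv b : Fin (d + n)).val).det =
      (Matrix.of fun a b => Sum.elim (fun i : Fin d => (f a %ₘ Q).coeff i)
        (fun i : Fin n => (f a /ₘ Q).coeff i) b : Matrix (Fin d ⊕ Fin n) (Fin d ⊕ Fin n) ℤ).det := by
  set e : ℕ → ℤ[X] := fun m => if m < d then X ^ m else X ^ (m - d) * Q with he
  have hem : ∀ m, (e m).Monic := by
    intro m
    simp only [he]
    split_ifs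
    · exact monic_X_pow m
    · exact (monic_X_pow _).mul hQ
  have hed : ∀ m, (e m).natDegree = m := by
    intro m
    simp only [he]
    split_ifs
    · simp
    · rw [(monic_X_pow _).natDegree_mul hQ, natDegree_X_pow, hQd]; omega
  have h1 := det_coeffMatrix_eq_one (n := d + n) e hem hed
  have hQd' : Q.degree = d := by rw [degree_eq_natDegree hQ.ne_zero, hQd]
  rw [← Matrix.det_submatrix_equiv_self finSumFinEquiv] at h1
  have key : (coeffMatrix f fun b => (finSumFinEquiv b : Fin (d + n)).val) =
      (Matrix.of fun a b => Sum.elim (fun i : Fin d => (f a %ₘ Q).coeff i)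
        (fun i : Fin n => (f a /ₘ Q).coeff i) b) *
      ((coeffMatrix (fun i : Fin (d + n) => e i) (fun j : Fin (d + n) => (j : ℕ))).submatrix
        finSumFinEquiv finSumFinEquiv) := by
    ext a b
    have hr := eq_sum_of_degree_lt ((degree_modByMonic_lt (f a) hQ).trans_eq hQd')
    have hq : f a /ₘ Q = ∑ i : Fin n, C ((f a /ₘ Q).coeff i) * X ^ (i : ℕ) := by
      refine eq_sum_of_degree_lt ?_
      by_cases hlt : (f a).degree < Q.degree
      · rw [(divByMonic_eq_zero_iff hQ).mpr hlt, degree_zero]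
        exact WithBot.bot_lt_coe n
      · have h2 := degree_add_divByMonic hQ (not_lt.mp hlt)
        have h3 := hf a
        rw [← h2, hQd', Nat.cast_add] at h3
        exact lt_of_add_lt_add_left h3
    have hfa : f a = ∑ i : Fin d, C ((f a %ₘ Q).coeff i) * X ^ (i : ℕ) +
        ∑ i : Fin n, C ((f a /ₘ Q).coeff i) * (X ^ (i : ℕ) * Q) := by
      conv_lhs => rw [← modByMonic_add_div (f a) Q, hr, hq, mul_comm Q, Finset.sum_mul]
      simp only [mul_assoc]
    rw [Matrix.mul_apply, Fintype.sum_sum_type]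
    simp only [coeffMatrix, Matrix.of_apply, Matrix.submatrix_apply, Sum.elim_inl, Sum.elim_inr]
    conv_lhs => rw [hfa]
    simp only [coeff_add, finsetSum_coeff, coeff_C_mul]
    simp [he]
  rw [key, Matrix.det_mul, h1, mul_one]

theorem sum_coeff_mul_apply_X_pow (Λ : ℤ[X] →ₗ[ℤ] ℤ) {n : ℕ} (f g : ℤ[X]) (hf : f.natDegree < n) :
    ∑ i : Fin n, f.coeff i * Λ (X ^ (i : ℕ) * g) = Λ (f * g) := by
  conv_rhs => rw [f.as_sum_range_C_mul_X_pow' hf, Finset.sum_mul, map_sum, Finset.sum_range]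
  refine Finset.sum_congr rfl fun i _ => ?_
  rw [mul_assoc, ← smul_eq_C_mul, map_smul, smul_eq_mul]

/-- Multiply the coefficient matrix by Λ(X^a p_b), which is triangular with diagonal h.
Orthogonality makes the product block triangular: one block is the wanted matrix with X^j replaced
by p_j, a unitriangular change, and the other is diagonal with entries h_(N+j), which cancel. -/
theorem det_functional_mul (Λ : ℤ[X] →ₗ[ℤ] ℤ) (p : ℕ → ℤ[X]) (h : ℕ → ℤ)
    (hm : ∀ m, (p m).Monic) (hd : ∀ m, (p m).natDegree = m)
    (horth : ∀ i m, i < m → Λ (X ^ i * p m) = 0) (hnorm : ∀ m, Λ (X ^ m * p m) = h m)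
    (hne : ∀ m, h m ≠ 0) {N d : ℕ} (Q : ℤ[X]) (hQ : Q.natDegree = d) (hQm : Q.Monic) :
    (Matrix.of fun i j : Fin N => Λ (X ^ ((i : ℕ) + j) * Q)).det =
      (∏ m : Fin N, h m) *
      (coeffMatrix (Sum.elim (fun i : Fin N => X ^ (i : ℕ) * Q) (fun j : Fin d => p (N + j)))
        fun b => (finSumFinEquiv b : Fin (N + d)).val).det := by
  have orth : ∀ (f : ℤ[X]) m, f.natDegree < m → Λ (f * p m) = 0 := by
    intro f m hf
    rw [← sum_coeff_mul_apply_X_pow Λ f (p m) hf]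
    exact Finset.sum_eq_zero fun i _ => by rw [horth _ _ i.2, mul_zero]
  have norm : ∀ m, Λ (p m * p m) = h m := by
    intro m
    rw [← sum_coeff_mul_apply_X_pow Λ (n := m + 1) (p m) (p m) (by rw [hd]; omega),
      Fin.sum_univ_castSucc]
    rw [Finset.sum_eq_zero fun i _ => by
      rw [Fin.val_castSucc, horth _ _ i.2, mul_zero]]
    have := (hm m).coeff_natDegree
    rw [hd] at this
    simp [this, hnorm]
  set F : Fin N ⊕ Fin d → ℤ[X] :=
    Sum.elim (fun i : Fin N => X ^ (i : ℕ) * Q) (fun j : Fin d => p (N + j)) with hF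
  have hFd : ∀ a, (F a).natDegree < N + d := by
    rintro (i | j)
    · simp only [hF, Sum.elim_inl]
      rw [(monic_X_pow _).natDegree_mul hQm, natDegree_X_pow, hQ]; omega
    · simp only [hF, Sum.elim_inr, hd]; omega
  set H : Matrix (Fin (N + d)) (Fin (N + d)) ℤ := Matrix.of fun a b => Λ (X ^ (a : ℕ) * p b)
    with hH
  have hHdet : H.det = (∏ m : Fin N, h m) * ∏ m : Fin d, h (N + m) := by
    rw [Matrix.det_of_isLowerTriangular, Fin.prod_univ_add]
    · simp [hH, hnorm]
    · intro i j hij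
      exact horth _ _ hij
  have hprod : (coeffMatrix F fun b => (finSumFinEquiv b : Fin (N + d)).val) *
      H.submatrix finSumFinEquiv finSumFinEquiv =
      Matrix.fromBlocks (Matrix.of fun i j : Fin N => Λ (X ^ (i : ℕ) * Q * p j))
        (Matrix.of fun (i : Fin N) (j : Fin d) => Λ (X ^ (i : ℕ) * Q * p (N + j))) 0
        (Matrix.diagonal fun j : Fin d => h (N + j)) := by
    ext a b
    have : ((coeffMatrix F fun b => (finSumFinEquiv b : Fin (N + d)).val) *
      H.submatrix finSumFinEquiv finSumFinEquiv) a b =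
        Λ (F a * p (finSumFinEquiv b : Fin (N + d)).val) := by
      rw [← sum_coeff_mul_apply_X_pow Λ _ _ (hFd a), Matrix.mul_apply,
        ← finSumFinEquiv.sum_comp]
      rfl
    rw [this]
    rcases a with a | a <;> rcases b with b | b
    · simp [hF]
    · simp [hF]
    · simp only [hF, Sum.elim_inr, Matrix.fromBlocks_apply₂₁, Matrix.zero_apply,
        finSumFinEquiv_apply_left, Fin.val_castAdd]
      rw [mul_comm]
      exact orth _ _ (by rw [hd]; omega)
    · simp only [hF, Sum.elim_inr, Matrix.fromBlocks_apply₂₂,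
        finSumFinEquiv_apply_right, Fin.val_natAdd]
      rcases lt_trichotomy a b with hab | rfl | hab
      · rw [Matrix.diagonal_apply_ne _ hab.ne]
        exact orth _ _ (by rw [hd]; simpa using hab)
      · rw [Matrix.diagonal_apply_eq]
        exact norm _
      · rw [Matrix.diagonal_apply_ne _ hab.ne', mul_comm]
        exact orth _ _ (by rw [hd]; simpa using hab)
  have hleft : (Matrix.of fun i j : Fin N => Λ (X ^ ((i : ℕ) + j) * Q)).det =
      (Matrix.of fun i j : Fin N => Λ (X ^ (i : ℕ) * Q * p j)).det := by
    have : (Matrix.of fun i j : Fin N => Λ (X ^ (i : ℕ) * Q * p j)) =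
        (Matrix.of fun i j : Fin N => Λ (X ^ ((i : ℕ) + j) * Q)) *
        (coeffMatrix (fun i : Fin N => p i) (fun j : Fin N => (j : ℕ)))ᵀ := by
      ext i j
      rw [Matrix.mul_apply]
      simp only [Matrix.of_apply, Matrix.transpose_apply, coeffMatrix]
      rw [mul_comm, ← sum_coeff_mul_apply_X_pow Λ (n := N) _ _ (by rw [hd]; exact j.2)]
      refine Finset.sum_congr rfl fun m _ => ?_
      rw [mul_comm, pow_add]
      ring_nf
    rw [this, Matrix.det_mul, Matrix.det_transpose, det_coeffMatrix_eq_one p hm hd, mul_one]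
  have := congrArg Matrix.det hprod
  rw [Matrix.det_mul, Matrix.det_submatrix_equiv_self, Matrix.det_fromBlocks_zero₂₁,
    Matrix.det_diagonal, hHdet, ← hleft] at this
  have hprod_ne : ∏ m : Fin d, h (N + m) ≠ 0 := Finset.prod_ne_zero_iff.mpr fun m _ => hne (N + m)
  refine mul_right_cancel₀ hprod_ne ?_
  rw [← this]
  ring

end Determinants

/-! ### Reduction to size 2k and splitting of the small determinant. -/

section Reduction
open Polynomial Matrix

/-- The matrix of the first coefficients of the remainders and of the quotients of a family of
polynomials upon division by `W`. -/
noncomputable def modDivMatrix (k : ℕ) (W : ℤ[X]) {ι : Type*} (g : ι → ℤ[X]) :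
    Matrix ι (Fin k ⊕ Fin k) ℤ :=
  Matrix.of fun a b => Sum.elim (fun i : Fin k => (g a %ₘ W).coeff i)
    (fun i : Fin k => (g a /ₘ W).coeff i) b

/-- Dividing by X^k W turns the rows X^i X^k W into an identity block, leaving the remainders of the
p_(N+j). These are divided once more, by W. -/
theorem det_functional_eq_modDivMatrix (Λ : ℤ[X] →ₗ[ℤ] ℤ) (p : ℕ → ℤ[X]) (h : ℕ → ℤ)
    (hm : ∀ m, (p m).Monic) (hd : ∀ m, (p m).natDegree = m)
    (horth : ∀ i m, i < m → Λ (X ^ i * p m) = 0) (hnorm : ∀ m, Λ (X ^ m * p m) = h m)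
    (hne : ∀ m, h m ≠ 0) {N k : ℕ} (W : ℤ[X]) (hW : W.natDegree = k) (hWm : W.Monic) :
    (Matrix.of fun i j : Fin N => Λ (X ^ ((i : ℕ) + j) * (X ^ k * W))).det =
      (∏ m : Fin N, h m) *
      (modDivMatrix k W fun a : Fin k ⊕ Fin k => p (N + (finSumFinEquiv a : Fin (k + k)))).det := by
  have hQm : (X ^ k * W).Monic := (monic_X_pow k).mul hWm
  have hQ : (X ^ k * W).natDegree = k + k := by
    rw [(monic_X_pow k).natDegree_mul hWm, natDegree_X_pow, hW]
  have hQd : (X ^ k * W).degree = ((k + k : ℕ) : WithBot ℕ) := by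
    rw [degree_eq_natDegree hQm.ne_zero, hQ]
  have hWd : W.degree = k := by rw [degree_eq_natDegree hWm.ne_zero, hW]
  rw [det_functional_mul Λ p h hm hd horth hnorm hne (X ^ k * W) hQ hQm]
  congr 1
  set F : Fin N ⊕ Fin (k + k) → ℤ[X] :=
    Sum.elim (fun i : Fin N => X ^ (i : ℕ) * (X ^ k * W)) (fun j : Fin (k + k) => p (N + j)) with hF
  have hFd : ∀ a, (F a).degree < (k + k + N : ℕ) := by
    rintro (i | j)
    · simp only [hF, Sum.elim_inl]
      rw [degree_eq_natDegree ((monic_X_pow _).mul hQm).ne_zero, (monic_X_pow _).natDegree_mul hQm,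
        natDegree_X_pow, hQ]
      exact_mod_cast (by omega)
    · simp only [hF, Sum.elim_inr]
      rw [degree_eq_natDegree (hm _).ne_zero, hd]
      exact_mod_cast (by omega)
  have hswap := det_submatrix_finSum_swap (N := N) (d := k + k) ⟨k, rfl⟩
    (coeffMatrix F fun b : ℕ => b)
  refine hswap.trans ?_
  have hdiv := det_coeffMatrix_eq_mod_div (n := N) (X ^ k * W) hQm hQ (F ∘ Sum.swap)
    fun a => hFd _
  refine Eq.trans ?_ (hdiv.trans ?_)
  · rfl
  have hblocks : (Matrix.of fun (a b : Fin (k + k) ⊕ Fin N) =>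
      Sum.elim (fun i : Fin (k + k) => ((F ∘ Sum.swap) a %ₘ (X ^ k * W)).coeff i)
        (fun i : Fin N => ((F ∘ Sum.swap) a /ₘ (X ^ k * W)).coeff i) b) =
      Matrix.fromBlocks
        (coeffMatrix (fun j : Fin (k + k) => p (N + j) %ₘ (X ^ k * W)) fun b : Fin (k + k) => b.val)
        (coeffMatrix (fun j : Fin (k + k) => p (N + j) /ₘ (X ^ k * W)) fun b : Fin N => b.val)
        0 1 := by
    ext a b
    have hmul : ∀ i : ℕ, (X ^ i * (X ^ k * W)) %ₘ (X ^ k * W) = 0 := fun i =>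
      (modByMonic_eq_zero_iff_dvd hQm).mpr (Dvd.intro_left _ rfl)
    have hmul' : ∀ i : ℕ, (X ^ i * (X ^ k * W)) /ₘ (X ^ k * W) = X ^ i := fun i => by
      rw [mul_comm, mul_divByMonic_cancel_left _ hQm]
    rcases a with a | a <;> rcases b with b | b
    · rfl
    · rfl
    · simp [hF, hmul]
    · simp [hF, hmul', coeff_X_pow, Matrix.one_apply, Fin.ext_iff, eq_comm]
  rw [hblocks, Matrix.det_fromBlocks_zero₂₁, Matrix.det_one, mul_one,
    ← Matrix.det_submatrix_equiv_self (finSumFinEquiv (m := k) (n := k))]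
  refine (det_coeffMatrix_eq_mod_div W hWm hW
    (fun a : Fin k ⊕ Fin k => p (N + (finSumFinEquiv a : Fin (k + k))) %ₘ (X ^ k * W))
    fun a => (degree_modByMonic_lt _ hQm).trans_eq hQd).trans ?_
  congr 1
  ext a b
  set f := p (N + (finSumFinEquiv a : Fin (k + k)))
  -- Reducing modulo X^k W first changes the quotient by W only by a multiple of X^k, so its first k
  -- coefficients survive.
  have huniq := div_modByMonic_unique (f := f)
    ((f %ₘ (X ^ k * W)) /ₘ W + X ^ k * (f /ₘ (X ^ k * W))) ((f %ₘ (X ^ k * W)) %ₘ W) hWm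
    ⟨by
      have h1 := modByMonic_add_div f (X ^ k * W)
      have h2 := modByMonic_add_div (f %ₘ (X ^ k * W)) W
      linear_combination h1 + h2, degree_modByMonic_lt _ hWm⟩
  rcases b with b | b
  · simp only [modDivMatrix, Matrix.of_apply, Sum.elim_inl]
    rw [← huniq.2]
  · simp only [modDivMatrix, Matrix.of_apply, Sum.elim_inr]
    change _ = (f /ₘ W).coeff b
    rw [huniq.1, coeff_add, coeff_X_pow_mul', if_neg (by have := b.2; omega), add_zero]

/-- Expanding τ_s in monomials, `hg` permits replacing g_s by g_j in the X^j term. The matrix is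
then a unitriangular one times the upper triangular one of the X^j g_j. Letting g vary is needed
only for `det_modDivMatrix_center_sub`. -/
theorem det_coeffMatrix_mul {k : ℕ} (τ g : ℕ → ℤ[X]) (hm : ∀ m, (τ m).Monic)
    (hd : ∀ m, (τ m).natDegree = m) (hg : ∀ s j, (τ s).coeff j ≠ 0 → g j = g s) :
    (coeffMatrix (fun s : Fin k => τ s * g s) fun i : Fin k => i.val).det =
      ∏ s : Fin k, (g s).coeff 0 := by
  have h : coeffMatrix (fun s : Fin k => τ s * g s) (fun i : Fin k => i.val) =
      coeffMatrix (fun s : Fin k => τ s) (fun i : Fin k => i.val) *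
      coeffMatrix (fun j : Fin k => X ^ (j : ℕ) * g j) (fun i : Fin k => i.val) := by
    ext s i
    rw [Matrix.mul_apply]
    simp only [coeffMatrix, Matrix.of_apply]
    have hs := eq_sum_of_degree_lt (f := τ s) (n := k) (by
      rw [degree_eq_natDegree (hm _).ne_zero, hd]; exact_mod_cast s.2)
    conv_lhs => rw [hs, Finset.sum_mul, finsetSum_coeff]
    refine Finset.sum_congr rfl fun j _ => ?_
    rw [mul_assoc, coeff_C_mul]
    by_cases hz : (τ s).coeff j = 0
    · simp [hz]
    · rw [hg s j hz]
  rw [h, Matrix.det_mul, det_coeffMatrix_eq_one τ hm hd, one_mul, Matrix.det_of_isUpperTriangular]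
  · refine Finset.prod_congr rfl fun j _ => ?_
    simp [coeffMatrix, coeff_X_pow_mul']
  · intro i j hij
    simp only [coeffMatrix, Matrix.of_apply]
    rw [coeff_X_pow_mul', if_neg (not_le.mpr (show (j : ℕ) < i from hij))]

/-- Row operations with E turn the β rows into multiples of W, whose remainders vanish and whose
quotients are γ. The matrix becomes block triangular. -/
theorem det_modDivMatrix {k : ℕ} (W : ℤ[X]) (hWm : W.Monic) (α β γ : Fin k → ℤ[X])
    (E : Matrix (Fin k) (Fin k) ℤ) (hE : ∀ s, β s + ∑ j, C (E s j) * α j = W * γ s) :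
    (modDivMatrix k W (Sum.elim α β)).det =
      (coeffMatrix (fun j => α j %ₘ W) fun i : Fin k => i.val).det *
      (coeffMatrix γ fun i : Fin k => i.val).det := by
  have huniq : ∀ s, β s /ₘ W = γ s - ∑ j, C (E s j) * (α j /ₘ W) ∧
      β s %ₘ W = -∑ j, C (E s j) * (α j %ₘ W) := by
    intro s
    refine div_modByMonic_unique _ _ hWm ⟨?_, ?_⟩
    · have h1 : ∑ j, C (E s j) * α j =
          ∑ j, C (E s j) * (α j %ₘ W) + W * ∑ j, C (E s j) * (α j /ₘ W) := by
        rw [Finset.mul_sum, ← Finset.sum_add_distrib]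
        refine Finset.sum_congr rfl fun j _ => ?_
        linear_combination - C (E s j) * modByMonic_add_div (α j) W
      linear_combination h1 - hE s
    · rw [degree_neg]
      refine (degree_sum_le _ _).trans_lt ((Finset.sup_lt_iff ?_).mpr fun j _ => ?_)
      · exact bot_lt_iff_ne_bot.mpr (degree_ne_bot.mpr hWm.ne_zero)
      · rw [← smul_eq_C_mul]
        exact (degree_smul_le _ _).trans_lt (degree_modByMonic_lt _ hWm)
  have hmul : Matrix.fromBlocks 1 0 E 1 * modDivMatrix k W (Sum.elim α β) =
      Matrix.fromBlocks (coeffMatrix (fun j => α j %ₘ W) fun i : Fin k => i.val)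
        (coeffMatrix (fun j => α j /ₘ W) fun i : Fin k => i.val) 0
        (coeffMatrix γ fun i : Fin k => i.val) := by
    ext a b
    rw [Matrix.mul_apply, Fintype.sum_sum_type]
    rcases a with a | a <;> rcases b with b | b
    · simp [modDivMatrix, coeffMatrix, Matrix.one_apply]
    · simp [modDivMatrix, coeffMatrix, Matrix.one_apply]
    · simp [modDivMatrix, coeffMatrix, Matrix.one_apply, (huniq a).2, finsetSum_coeff]
    · simp [modDivMatrix, coeffMatrix, Matrix.one_apply, (huniq a).1, finsetSum_coeff]
  have := congrArg Matrix.det hmul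
  rwa [Matrix.det_mul, Matrix.det_fromBlocks_zero₁₂, Matrix.det_fromBlocks_zero₂₁, Matrix.det_one,
    one_mul, one_mul] at this

theorem det_coeffMatrix_modByMonic {k : ℕ} (W : ℤ[X]) (hWm : W.Monic) (hWd : W.natDegree = k)
    (p : ℕ → ℤ[X]) (hm : ∀ m, (p m).Monic) (hd : ∀ m, (p m).natDegree = m) (α : Fin k → ℤ[X])
    (v : ℕ → ℤ) (hα : ∀ j : Fin k, W ∣ α j - C (v j) * p j) :
    (coeffMatrix (fun j => α j %ₘ W) fun i : Fin k => i.val).det = ∏ j : Fin k, v j := by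
  have h : (coeffMatrix (fun j => α j %ₘ W) fun i : Fin k => i.val) =
      Matrix.diagonal (fun j : Fin k => v j) *
        coeffMatrix (fun j : Fin k => p j) fun i : Fin k => i.val := by
    ext j i
    rw [Matrix.diagonal_mul]
    simp only [coeffMatrix, Matrix.of_apply]
    obtain ⟨q, hq⟩ := hα j
    rw [(div_modByMonic_unique q (C (v j) * p j) hWm ⟨by linear_combination -hq, ?_⟩).2,
      coeff_C_mul]
    rw [← smul_eq_C_mul]
    refine (degree_smul_le _ _).trans_lt ?_
    rw [degree_eq_natDegree (hm _).ne_zero, degree_eq_natDegree hWm.ne_zero, hd, hWd]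
    exact_mod_cast j.2
  rw [h, Matrix.det_mul, Matrix.det_diagonal, det_coeffMatrix_eq_one p hm hd, mul_one]

/-- The case of a centre k-1 whose polynomial is itself divisible by W. The unpaired last row is
rotated to the front, where it supplies the residue of p_0; the cycle has even length 2k, whence the
minus sign. -/
theorem det_modDivMatrix_center_add {k : ℕ} (hk : 0 < k) (W G : ℤ[X]) (hWm : W.Monic)
    (hWd : W.natDegree = k) (p τ q : ℕ → ℤ[X]) (hm : ∀ m, (p m).Monic)
    (hd : ∀ m, (p m).natDegree = m) (hτm : ∀ m, (τ m).Monic) (hτd : ∀ m, (τ m).natDegree = m)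
    (v : ℕ → ℤ) (h0 : W ∣ q (k + k - 1) - C (v 0) * p 0)
    (hj : ∀ j, 0 < j → j < k → W ∣ q (j - 1) - C (v j) * p j)
    (hs0 : q (k - 1) = W * G)
    (hs : ∀ s, 0 < s → s < k → q (k - 1 + s) + q (k - 1 - s) = W * (τ s * G)) :
    (modDivMatrix k W fun a : Fin k ⊕ Fin k => q (finSumFinEquiv a : Fin (k + k))).det =
      -(∏ j : Fin k, v j) * G.coeff 0 ^ k := by
  obtain ⟨k, rfl⟩ := Nat.exists_eq_succ_of_ne_zero hk.ne'
  have hτ0 : τ 0 = 1 := by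
    have := (hτm 0).natDegree_eq_zero.mp (hτd 0)
    exact this
  set r : ℕ → ℤ[X] := fun t => if t = 0 then q (k + 1 + k) else q (t - 1) with hr
  have hrot : (modDivMatrix (k + 1) W fun a : Fin (k + 1) ⊕ Fin (k + 1) =>
      q (finSumFinEquiv a : Fin (k + 1 + (k + 1)))).det =
      -(modDivMatrix (k + 1) W (Sum.elim (fun j : Fin (k + 1) => r j)
        fun s : Fin (k + 1) => r (k + 1 + s))).det := by
    have hsum : (Sum.elim (fun j : Fin (k + 1) => r j) fun s : Fin (k + 1) => r (k + 1 + s)) =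
        fun a => r (finSumFinEquiv a : Fin (k + 1 + (k + 1))) := by
      ext1 a
      rcases a with a | a <;> simp [add_comm]
    have hsr : Equiv.Perm.sign (finRotate (k + 1 + (k + 1))) = -1 := by
      rw [sign_finRotate]
      exact Odd.neg_one_pow ⟨k, by omega⟩
    have h1 := Matrix.det_permute ((finSumFinEquiv (m := k + 1) (n := k + 1)).symm.permCongr
      (finRotate (k + 1 + (k + 1)))) (modDivMatrix (k + 1) W
        fun a => r (finSumFinEquiv a : Fin (k + 1 + (k + 1))))
    rw [Equiv.Perm.sign_permCongr, hsr] at h1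
    simp only [Units.val_neg, Units.val_one, Int.cast_neg, Int.cast_one, neg_mul, one_mul] at h1
    rw [hsum, ← h1]
    congr 1
    ext a b
    have hval := coe_finRotate (n := k + 1 + k) (finSumFinEquiv a : Fin (k + 1 + (k + 1)))
    have : q (finSumFinEquiv a : Fin (k + 1 + (k + 1))) =
        r (finRotate (k + 1 + (k + 1)) (finSumFinEquiv a : Fin (k + 1 + (k + 1)))) := by
      simp only [hr]
      refine Eq.trans ?_ (congrArg r hval).symm
      simp only [hr]
      split_ifs with h <;> simp_all
    simp only [Matrix.submatrix_apply, id_eq, modDivMatrix, Matrix.of_apply,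
      Equiv.permCongr_apply, Equiv.symm_symm, Equiv.apply_symm_apply]
    rw [this]
  rw [hrot, det_modDivMatrix W hWm _ _ (fun s => τ s * G)
    (Matrix.of fun s j => if (s : ℕ) + j = k + 1 then 1 else 0),
    det_coeffMatrix_modByMonic W hWm hWd p hm hd _ v, det_coeffMatrix_mul τ (fun _ => G) hτm hτd]
  · simp
  · intros; rfl
  · intro j
    by_cases hj0 : (j : ℕ) = 0
    · rw [hj0]
      exact h0
    · simp only [hr, if_neg hj0]
      exact hj j (by omega) j.2
  · intro s
    have hβ : r (k + 1 + s) = q (k + s) := by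
      simp only [hr]
      rw [if_neg (by omega)]
      congr 1
      omega
    rw [hβ]
    by_cases hs1 : (s : ℕ) = 0
    · rw [Finset.sum_eq_zero]
      · simpa [hs1, hτ0] using hs0
      · intro j _
        have : ¬ (s : ℕ) + j = k + 1 := by have := j.2; omega
        simp [this]
    · rw [Finset.sum_eq_single ⟨k + 1 - s, by omega⟩]
      · have h1 := hs s (by omega) s.2
        have hα : r (k + 1 - s) = q (k - s) := by
          simp only [hr]
          rw [if_neg (by omega)]
          congr 1
          omega
        have h2 : (s : ℕ) + (k + 1 - s) = k + 1 := by omega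
        simpa [hα, h2] using h1
      · intro j _ hne
        have : ¬ (s : ℕ) + j = k + 1 := fun h => hne (Fin.ext (by simp; omega))
        simp [this]
      · simp

/-- The case where differences about the centre k-1 are divisible by W, while the centre itself
supplies the residue of p_0 and the unpaired last row is divisible by W. Residues occur in reversed
order, giving (-1)^(k choose 2); rotating the last cofactor G to the front gives (-1)^(k-1). -/
theorem det_modDivMatrix_center_sub {k : ℕ} (hk : 0 < k) (W G H : ℤ[X]) (hWm : W.Monic)
    (hWd : W.natDegree = k) (p u q : ℕ → ℤ[X]) (hm : ∀ m, (p m).Monic)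
    (hd : ∀ m, (p m).natDegree = m) (hum : ∀ m, (u m).Monic) (hud : ∀ m, (u m).natDegree = m)
    (v : ℕ → ℤ) (hj : ∀ j, j < k → W ∣ q (k - 1 - j) - C (v j) * p j)
    (hs0 : q (k + k - 1) = W * G)
    (hs : ∀ s, s + 1 < k → q (k + s) - q (k - 2 - s) = W * (X * u s * H)) :
    (modDivMatrix k W fun a : Fin k ⊕ Fin k => q (finSumFinEquiv a : Fin (k + k))).det =
      (-1) ^ (k.choose 2 + (k - 1)) * (∏ j : Fin k, v j) * (G.coeff 0 * H.coeff 0 ^ (k - 1)) := by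
  obtain ⟨k, rfl⟩ := Nat.exists_eq_succ_of_ne_zero hk.ne'
  have hcol : (fun a : Fin (k + 1) ⊕ Fin (k + 1) => q (finSumFinEquiv a : Fin (k + 1 + (k + 1)))) =
      Sum.elim (fun j : Fin (k + 1) => q j) fun s : Fin (k + 1) => q (k + 1 + s) := by
    ext1 a
    rcases a with a | a <;> simp [add_comm]
  -- For s > 0 the factor X in τ_s kills the constant term, so the index 0 carrying G never mixes
  -- with the indices carrying H.
  set τ : ℕ → ℤ[X] := fun s => if s = 0 then 1 else X * u (s - 1) with hτ
  set g : ℕ → ℤ[X] := fun s => if s = 0 then G else H with hg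
  have hA : (coeffMatrix (fun j : Fin (k + 1) => q j %ₘ W) fun i : Fin (k + 1) => i.val).det =
      (-1) ^ (k + 1).choose 2 * ∏ j : Fin (k + 1), v j := by
    have h1 := Matrix.det_permute Fin.revPerm
      (coeffMatrix (fun j : Fin (k + 1) => q j %ₘ W) fun i : Fin (k + 1) => i.val)
    rw [sign_revPerm] at h1
    have h2 := det_coeffMatrix_modByMonic W hWm hWd p hm hd
      (fun j : Fin (k + 1) => q (Fin.rev j)) v fun j => by
        have := hj j j.2
        rwa [Fin.val_rev, show k + 1 - (j + 1 : ℕ) = k + 1 - 1 - j by omega]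
    rw [← h2]
    have h3 : ((coeffMatrix (fun j : Fin (k + 1) => q j %ₘ W)
        fun i : Fin (k + 1) => i.val).submatrix Fin.revPerm id) =
        coeffMatrix (fun j : Fin (k + 1) => q (Fin.rev j) %ₘ W) fun i : Fin (k + 1) => i.val := rfl
    rw [← h3, h1, ← mul_assoc]
    push_cast
    rw [← mul_pow]
    simp
  have hD : (coeffMatrix (fun s : Fin (k + 1) => if (s : ℕ) = k then G else X * u s * H)
      fun i : Fin (k + 1) => i.val).det = (-1) ^ k * (G.coeff 0 * H.coeff 0 ^ k) := by
    have h1 := Matrix.det_permute (finRotate (k + 1))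
      (coeffMatrix (fun s : Fin (k + 1) => τ s * g s) fun i : Fin (k + 1) => i.val)
    rw [sign_finRotate, det_coeffMatrix_mul τ g] at h1
    · rw [Fin.prod_univ_succ] at h1
      simp only [Nat.add_sub_cancel] at h1
      convert h1 using 1
      · congr 1
        ext s i
        simp only [coeffMatrix, Matrix.submatrix_apply, Matrix.of_apply, id_eq]
        rcases eq_or_ne s (Fin.last k) with rfl | hne
        · simp [hτ, hg]
        · have hlt : (s : ℕ) < k := Fin.val_lt_last hne
          rw [coe_finRotate_of_ne_last hne]
          simp [hτ, hg, hlt.ne]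
      · simp [hg]
    · intro m
      simp only [hτ]
      split_ifs
      · exact monic_one
      · exact monic_X.mul (hum _)
    · intro m
      simp only [hτ]
      split_ifs with h
      · simp [h]
      · rw [monic_X.natDegree_mul (hum _), natDegree_X, hud]; omega
    · intro s j hc
      simp only [hτ, hg] at hc ⊢
      by_cases hs : s = 0
      · rw [if_pos hs, coeff_one] at hc
        simp_all
      · rw [if_neg hs] at hc
        have : j ≠ 0 := by rintro rfl; simp at hc
        simp [hs, this]
  rw [hcol, det_modDivMatrix W hWm _ _
    (fun s : Fin (k + 1) => if (s : ℕ) = k then G else X * u s * H)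
    (Matrix.of fun s j => if (s : ℕ) + j + 1 = k then -1 else 0), hA, hD]
  · simp only [Nat.succ_eq_add_one, Nat.add_sub_cancel, pow_add]; ring
  · intro s
    by_cases hs1 : (s : ℕ) = k
    · rw [Finset.sum_eq_zero]
      · simpa [hs1, show k + 1 + (k + 1) - 1 = k + 1 + k by omega] using hs0
      · intro j _
        have : ¬ (s : ℕ) + j + 1 = k := by omega
        simp [this]
    · have hsk := s.2
      rw [Finset.sum_eq_single ⟨k - 1 - s, by omega⟩]
      · have h1 := hs s (by omega)
        have h2 : (s : ℕ) + (k - 1 - s) + 1 = k := by omega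
        rw [show k + 1 - 2 - (s : ℕ) = k - 1 - s by omega, sub_eq_add_neg] at h1
        simpa [hs1, h2] using h1
      · intro j _ hne
        have : ¬ (s : ℕ) + j + 1 = k := fun h => hne (Fin.ext (by simp; omega))
        simp [this]
      · simp

end Reduction

/-! ### Chebyshev polynomials in X = 4 cos²θ: identities, divisibility, values at 0. -/

section ShiftedChebyshev
open Polynomial

/-- The Chebyshev polynomial `2 cos (2 m θ)` as a polynomial in `4 cos ^ 2 θ`. -/
noncomputable def chebC (m : ℤ) : ℤ[X] := (Chebyshev.C ℤ m).comp (X - 2)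

/-- The Chebyshev polynomial `sin (2 (m + 1) θ) / sin (2 θ)` as a polynomial in `4 cos ^ 2 θ`. -/
noncomputable def chebS (m : ℤ) : ℤ[X] := (Chebyshev.S ℤ m).comp (X - 2)

/-- The Chebyshev polynomial `cos ((2 m + 1) θ) / cos θ` as a polynomial in `4 cos ^ 2 θ`. -/
noncomputable def chebV (m : ℤ) : ℤ[X] := chebS m - chebS (m - 1)

theorem chebC_add_one (m : ℤ) : chebC (m + 1) = (X - 2) * chebC m - chebC (m - 1) := by
  simp [chebC, Chebyshev.C_add_one]

theorem chebS_add_one (m : ℤ) : chebS (m + 1) = (X - 2) * chebS m - chebS (m - 1) := by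
  simp [chebS, Chebyshev.S_add_one]

theorem chebV_add_one (m : ℤ) : chebV (m + 1) = (X - 2) * chebV m - chebV (m - 1) := by
  have h := chebS_add_one (m - 1)
  rw [sub_add_cancel] at h
  simp only [chebV, add_sub_cancel_right, chebS_add_one m]
  linear_combination -h

theorem eq_of_recurrence {f g : ℤ → ℤ[X]} (hf : ∀ m, f (m + 1) = (X - 2) * f m - f (m - 1))
    (hg : ∀ m, g (m + 1) = (X - 2) * g m - g (m - 1)) (h0 : f 0 = g 0) (h1 : f 1 = g 1) (m : ℤ) :
    f m = g m := by
  suffices h : f m = g m ∧ f (m + 1) = g (m + 1) from h.1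
  induction m using Int.induction_on with
  | zero => exact ⟨h0, h1⟩
  | succ i ih =>
    refine ⟨ih.2, ?_⟩
    rw [hf, hg, add_sub_cancel_right, ih.1, ih.2]
  | pred i ih =>
    have h2 := hf (-i)
    have h3 := hg (-i)
    rw [sub_add_cancel]
    exact ⟨by linear_combination h2 - h3 + (X - 2) * ih.1 - ih.2, ih.1⟩

theorem chebC_zero : chebC 0 = 2 := by simp [chebC]

theorem chebC_one : chebC 1 = X - 2 := by simp [chebC]

theorem chebC_neg (m : ℤ) : chebC (-m) = chebC m := by simp [chebC]

theorem chebS_neg_one : chebS (-1) = 0 := by simp [chebS]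

theorem chebS_zero : chebS 0 = 1 := by simp [chebS]

theorem chebS_one : chebS 1 = X - 2 := by simp [chebS]

theorem chebV_zero : chebV 0 = 1 := by simp [chebV, chebS_zero, chebS_neg_one]

theorem chebV_one : chebV 1 = X - 3 := by
  simp only [chebV, chebS_one, sub_self, chebS_zero]; ring

theorem chebV_neg_one : chebV (-1) = 1 := by
  have h := chebV_add_one 0
  rw [zero_add, zero_sub, chebV_zero, chebV_one] at h
  linear_combination h

/-- As functions of b, both sides satisfy the recurrence and agree at 0 and 1. This serves C, S and
V alike. -/
theorem add_add_sub_of_recurrence {f : ℤ → ℤ[X]}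
    (hf : ∀ m, f (m + 1) = (X - 2) * f m - f (m - 1)) (a b : ℤ) :
    f (a + b) + f (a - b) = f a * chebC b := by
  refine eq_of_recurrence (f := fun b => f (a + b) + f (a - b)) (g := fun b => f a * chebC b)
    (fun m => ?_) (fun m => ?_) ?_ ?_ b
  · have h1 := hf (a + m)
    have h2 := hf (a - m)
    rw [show a + (m + 1) = a + m + 1 by ring, show a - (m + 1) = a - m - 1 by ring,
      show a + (m - 1) = a + m - 1 by ring, show a - (m - 1) = a - m + 1 by ring]
    linear_combination h1 + h2
  · simp only [chebC_add_one]; ring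
  · simp only [add_zero, sub_zero, chebC_zero]; ring
  · simp only [chebC_one, hf a]; ring

/-- The difference-of-cosines formula; X(X-4) = (X-2)² - 4 is -4 sin²(2θ). -/
theorem chebC_add_sub_chebC_sub (a b : ℤ) :
    chebC (a + b) - chebC (a - b) = X * (X - 4) * chebS (a - 1) * chebS (b - 1) := by
  have hS : ∀ m, chebS (m + 1 - 1) = (X - 2) * chebS (m - 1) - chebS (m - 1 - 1) := fun m => by
    rw [← chebS_add_one (m - 1)]; congr 1; ring
  have h1 : ∀ a, chebC (a + 1) - chebC (a - 1) = X * (X - 4) * chebS (a - 1) := by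
    intro a
    refine eq_of_recurrence (f := fun a => chebC (a + 1) - chebC (a - 1))
      (g := fun a => X * (X - 4) * chebS (a - 1)) (fun m => ?_) (fun m => ?_) ?_ ?_ a
    · have h1 := chebC_add_one (m + 1)
      have h2 := chebC_add_one (m - 1)
      rw [add_sub_cancel_right] at h1 ⊢
      rw [sub_add_cancel] at h2 ⊢
      linear_combination h1 - h2
    · simp only [hS]; ring
    · simp [chebS_neg_one, chebC_neg]
    · simp only [sub_self, chebS_zero, chebC_zero, chebC_add_one 1, chebC_one]; ring
  refine eq_of_recurrence (f := fun b => chebC (a + b) - chebC (a - b))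
    (g := fun b => X * (X - 4) * chebS (a - 1) * chebS (b - 1)) (fun m => ?_) (fun m => ?_) ?_ ?_ b
  · have h1 := chebC_add_one (a + m)
    have h2 := chebC_add_one (a - m)
    rw [show a + (m + 1) = a + m + 1 by ring, show a - (m + 1) = a - m - 1 by ring,
      show a + (m - 1) = a + m - 1 by ring, show a - (m - 1) = a - m + 1 by ring]
    linear_combination h1 - h2
  · simp only [hS]; ring
  · simp [chebS_neg_one]
  · simp [h1, chebS_zero]

/-- Antiperiodicity: C_(a+k) + C_(a-k) = C_a C_k, so a shift of the index by 2k changes the sign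
modulo C_k. -/
theorem chebC_dvd_chebC_add_sub (k : ℤ) (n : ℕ) (j : ℤ) :
    chebC k ∣ chebC (2 * k * n + j) - C ((-1) ^ n) * chebC j := by
  induction n with
  | zero => simp
  | succ n ih =>
    have h := add_add_sub_of_recurrence chebC_add_one (2 * k * n + j + k) k
    rw [add_sub_cancel_right] at h
    obtain ⟨q, hq⟩ := ih
    refine ⟨chebC (2 * k * n + j + k) - q, ?_⟩
    rw [show 2 * k * ((n + 1 : ℕ) : ℤ) + j = 2 * k * n + j + k + k by push_cast; ring, pow_succ,
      mul_neg_one, C_neg]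
    linear_combination h - hq

theorem chebV_neg_sub_one (m : ℤ) : chebV (-1 - m) = chebV m := by
  refine (eq_of_recurrence (f := chebV) (g := fun m => chebV (-1 - m)) chebV_add_one (fun m => ?_)
    ?_ ?_ m).symm
  · have h2 := chebV_add_one (-1 - m)
    rw [show -1 - (m + 1) = -1 - m - 1 by ring, show -1 - (m - 1) = -1 - m + 1 by ring]
    linear_combination h2
  · simp [chebV_neg_one, chebV_zero]
  · have h2 := chebV_add_one (-1)
    rw [neg_add_cancel, chebV_zero, chebV_neg_one] at h2
    rw [chebV_one]
    linear_combination -h2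

/-- V_(k+b) + V_(k-b) = V_k C_b together with the reflection m ↦ -1-m gives antiperiod 2k+1 modulo
V_k. -/
theorem chebV_dvd_chebV_add_sub (k : ℤ) (n : ℕ) (j : ℤ) :
    chebV k ∣ chebV ((2 * k + 1) * n + j) - C ((-1) ^ n) * chebV j := by
  induction n with
  | zero => simp
  | succ n ih =>
    have h := add_add_sub_of_recurrence chebV_add_one k ((2 * k + 1) * n + j + k + 1)
    rw [show k - ((2 * k + 1) * n + j + k + 1) = -1 - ((2 * k + 1) * n + j) by ring,
      chebV_neg_sub_one] at h
    obtain ⟨q, hq⟩ := ih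
    refine ⟨chebC ((2 * k + 1) * n + j + k + 1) - q, ?_⟩
    rw [show (2 * k + 1) * ((n + 1 : ℕ) : ℤ) + j = k + ((2 * k + 1) * n + j + k + 1) by
      push_cast; ring, pow_succ, mul_neg_one, C_neg]
    linear_combination h - hq

/-- Consecutive terms differ by S_(k-1) C_(2kn+k), and C_(2kn+k) is ±C_k modulo C_k. -/
theorem chebC_dvd_chebS (k : ℤ) (n : ℕ) : chebC k ∣ chebS (2 * k * n - 1) := by
  induction n with
  | zero => simp [chebS_neg_one]
  | succ n ih =>
    have hodd : ∀ m, chebS (-1 - m) = - chebS (m - 1) := fun m => by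
      have h := add_add_sub_of_recurrence chebS_add_one (-1) m
      rw [chebS_neg_one, zero_mul, neg_add_eq_sub] at h
      linear_combination h
    have h := add_add_sub_of_recurrence chebS_add_one (k - 1) (2 * k * n + k)
    rw [show k - 1 - (2 * k * n + k) = -1 - 2 * k * n by ring, hodd] at h
    obtain ⟨q, hq⟩ := chebC_dvd_chebC_add_sub k n k
    obtain ⟨t, ht⟩ := ih
    refine ⟨t + chebS (k - 1) * (q + C ((-1) ^ n)), ?_⟩
    rw [show 2 * k * ((n + 1 : ℕ) : ℤ) - 1 = k - 1 + (2 * k * n + k) by push_cast; ring]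
    linear_combination h + ht + chebS (k - 1) * hq

theorem monic_natDegree_of_recurrence {f : ℕ → ℤ[X]}
    (hf : ∀ m, f (m + 2) = (X - 2) * f (m + 1) - f m)
    {a : ℕ} (h0 : (f 0).Monic ∧ (f 0).natDegree = a) (h1 : (f 1).Monic ∧ (f 1).natDegree = a + 1)
    (m : ℕ) : (f m).Monic ∧ (f m).natDegree = a + m := by
  suffices h : ((f m).Monic ∧ (f m).natDegree = a + m) ∧
      ((f (m + 1)).Monic ∧ (f (m + 1)).natDegree = a + (m + 1)) from h.1
  induction m with
  | zero => exact ⟨h0, h1⟩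
  | succ m ih =>
    refine ⟨ih.2, ?_⟩
    obtain ⟨⟨hm, hd⟩, hm1, hd1⟩ := ih
    have hX : (X - 2 : ℤ[X]).Monic := monic_X_sub_C 2
    have hXd : (X - 2 : ℤ[X]).natDegree = 1 := natDegree_X_sub_C 2
    have hmul : ((X - 2) * f (m + 1)).natDegree = a + (m + 1 + 1) := by
      rw [hX.natDegree_mul hm1, hXd, hd1]; ring
    have hlt : (f m).degree < ((X - 2) * f (m + 1)).degree := by
      refine degree_lt_degree ?_
      rw [hmul, hd]; omega
    rw [hf]
    refine ⟨(hX.mul hm1).sub_of_left hlt, ?_⟩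
    rw [natDegree_sub_eq_left_of_natDegree_lt (by rw [hmul, hd]; omega), hmul]

theorem monic_chebC {m : ℕ} (hm : 0 < m) : (chebC m).Monic ∧ (chebC m).natDegree = m := by
  have h := monic_natDegree_of_recurrence (f := fun m : ℕ => chebC (m + 1 : ℕ)) (a := 1)
    (fun m => by
      have := chebC_add_one ((m : ℤ) + 2)
      push_cast
      rw [show (m : ℤ) + 2 - 1 = m + 1 by ring] at this
      rw [this, show (m : ℤ) + 2 = m + 1 + 1 by ring])
    ⟨by simpa [chebC_one] using monic_X_sub_C (2 : ℤ),
      by simpa [chebC_one] using natDegree_X_sub_C (2 : ℤ)⟩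
    (by
      have : chebC ((1 + 1 : ℕ) : ℤ) = X ^ 2 - C 4 * X + C 2 := by
        have := chebC_add_one 1
        rw [sub_self, chebC_one, chebC_zero] at this
        rw [Nat.cast_add, Nat.cast_one, this]
        simp only [map_ofNat]
        ring
      rw [this]
      constructor
      · monicity!
      · compute_degree!) (m - 1)
  rwa [Nat.sub_add_cancel hm, Nat.add_sub_cancel' hm] at h

theorem monic_chebS (m : ℕ) : (chebS m).Monic ∧ (chebS m).natDegree = m := by
  have h := monic_natDegree_of_recurrence (f := fun m : ℕ => chebS m) (a := 0)
    (fun m => by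
      have := chebS_add_one ((m : ℤ) + 1)
      push_cast
      rw [add_sub_cancel_right, add_assoc, one_add_one_eq_two] at this
      exact this)
    (by simp [chebS_zero])
    ⟨by simpa [chebS_one] using monic_X_sub_C (2 : ℤ),
      by simpa [chebS_one] using natDegree_X_sub_C (2 : ℤ)⟩ m
  rwa [zero_add] at h

theorem monic_chebV (m : ℕ) : (chebV m).Monic ∧ (chebV m).natDegree = m := by
  have h := monic_natDegree_of_recurrence (f := fun m : ℕ => chebV m) (a := 0)
    (fun m => by
      have := chebV_add_one ((m : ℤ) + 1)
      push_cast
      rw [add_sub_cancel_right, add_assoc, one_add_one_eq_two] at this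
      exact this)
    (by simp [chebV_zero])
    ⟨by simpa [chebV_one] using monic_X_sub_C (3 : ℤ),
      by simpa [chebV_one] using natDegree_X_sub_C (3 : ℤ)⟩ m
  rwa [zero_add] at h

theorem coeff_zero_chebC (m : ℕ) : (chebC m).coeff 0 = 2 * (-1) ^ m := by
  rw [coeff_zero_eq_eval_zero, chebC, eval_comp]
  simp

theorem coeff_zero_chebS (m : ℕ) : (chebS m).coeff 0 = (-1) ^ m * (m + 1) := by
  rw [coeff_zero_eq_eval_zero, chebS, eval_comp]
  simp

theorem coeff_zero_chebV (m : ℕ) : (chebV m).coeff 0 = (-1) ^ m * (2 * m + 1) := by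
  rcases m with _ | m
  · simp [chebV_zero]
  · rw [chebV, coeff_sub, coeff_zero_chebS, show ((m + 1 : ℕ) : ℤ) - 1 = (m : ℕ) by simp,
      coeff_zero_chebS]
    push_cast
    ring

end ShiftedChebyshev

/-! ### Moment functionals and orthogonality. -/

section Moments
open Polynomial

/-- The linear functional on polynomials with moments `binom (2 n + s) n`. -/
noncomputable def binomialFunctional (s : ℕ) : ℤ[X] →ₗ[ℤ] ℤ :=
  (basisMonomials ℤ).constr ℤ fun n => ((2 * n + s).choose n : ℤ)

theorem binomialFunctional_X_pow (s n : ℕ) :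
    binomialFunctional s (X ^ n) = ((2 * n + s).choose n : ℤ) := by
  have h := (basisMonomials ℤ).constr_basis ℤ (fun n => ((2 * n + s).choose n : ℤ)) n
  simp only [coe_basisMonomials] at h
  rwa [monomial_one_right_eq_X_pow] at h

/-- Pascal's rule applied twice is exactly the three-term recurrence with X - 2. Orthogonality
follows, since the binomial coefficient vanishes for m > n. -/
theorem binomialFunctional_of_recurrence (s : ℕ) (c : ℤ) {f : ℕ → ℤ[X]}
    (hf : ∀ m, f (m + 2) = (X - 2) * f (m + 1) - f m)
    (h0 : ∀ n, binomialFunctional s (X ^ n * f 0) = c * ((2 * n + s).choose (n + s) : ℤ))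
    (h1 : ∀ n, binomialFunctional s (X ^ n * f 1) = c * ((2 * n + s).choose (n + s + 1) : ℤ))
    (n m : ℕ) :
    binomialFunctional s (X ^ n * f m) = c * ((2 * n + s).choose (n + s + m) : ℤ) := by
  suffices h : ∀ n, binomialFunctional s (X ^ n * f m) = c * ((2 * n + s).choose (n + s + m) : ℤ) ∧
      binomialFunctional s (X ^ n * f (m + 1)) = c * ((2 * n + s).choose (n + s + (m + 1)) : ℤ) from
    (h n).1
  induction m with
  | zero => exact fun n => ⟨h0 n, h1 n⟩
  | succ m ih =>
    intro n
    refine ⟨(ih n).2, ?_⟩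
    have hX : X ^ n * f (m + 1 + 1) =
        X ^ (n + 1) * f (m + 1) - (2 : ℤ) • (X ^ n * f (m + 1)) - X ^ n * f m := by
      rw [hf, zsmul_eq_mul]; push_cast; ring
    rw [hX, map_sub, map_sub, map_smul, (ih n).1, (ih n).2, (ih (n + 1)).2, smul_eq_mul,
      show 2 * (n + 1) + s = 2 * n + s + 1 + 1 by ring,
      show n + 1 + s + (m + 1) = n + s + m + 1 + 1 by ring, Nat.choose_succ_succ',
      Nat.choose_succ_succ', Nat.choose_succ_succ',
      show n + s + (m + 1) = n + s + m + 1 by ring,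
      show n + s + (m + 1 + 1) = n + s + m + 1 + 1 by ring]
    push_cast
    ring

theorem binomialFunctional_zero_chebC (n m : ℕ) :
    binomialFunctional 0 (X ^ n * chebC m) = 2 * ((2 * n).choose (n + m) : ℤ) := by
  have h := binomialFunctional_of_recurrence 0 2 (f := fun m : ℕ => chebC m) (fun m => by
      have := chebC_add_one ((m : ℤ) + 1)
      push_cast
      rw [add_sub_cancel_right, add_assoc, one_add_one_eq_two] at this
      exact this)
    (fun n => by
      rw [Nat.cast_zero, chebC_zero, show X ^ n * (2 : ℤ[X]) = (2 : ℤ) • X ^ n by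
        rw [zsmul_eq_mul]; push_cast; ring, map_smul, binomialFunctional_X_pow]
      rfl)
    (fun n => by
      rw [Nat.cast_one, chebC_one, show X ^ n * (X - 2 : ℤ[X]) = X ^ (n + 1) - (2 : ℤ) • X ^ n by
        rw [zsmul_eq_mul]; push_cast; ring, map_sub, map_smul, binomialFunctional_X_pow,
        binomialFunctional_X_pow, smul_eq_mul, add_zero, add_zero, add_zero,
        show 2 * (n + 1) = 2 * n + 1 + 1 by ring, Nat.choose_succ_succ']
      have h2 : (2 * n + 1).choose n = (2 * n + 1).choose (n + 1) :=
        Nat.choose_symm_of_eq_add (by omega)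
      rw [h2, Nat.choose_succ_succ']
      push_cast
      ring) n m
  simpa using h

theorem binomialFunctional_one_chebV (n m : ℕ) :
    binomialFunctional 1 (X ^ n * chebV m) = ((2 * n + 1).choose (n + 1 + m) : ℤ) := by
  have h := binomialFunctional_of_recurrence 1 1 (f := fun m : ℕ => chebV m) (fun m => by
      have := chebV_add_one ((m : ℤ) + 1)
      push_cast
      rw [add_sub_cancel_right, add_assoc, one_add_one_eq_two] at this
      exact this)
    (fun n => by
      rw [Nat.cast_zero, chebV_zero, mul_one, binomialFunctional_X_pow, one_mul]
      exact_mod_cast Nat.choose_symm_of_eq_add (by omega))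
    (fun n => by
      have h2 : (2 * n + 1).choose n = (2 * n + 1).choose (n + 1) :=
        Nat.choose_symm_of_eq_add (by omega)
      have h3 : (2 * (n + 1) + 1).choose (n + 1) = (2 * (n + 1) + 1).choose (n + 1 + 1) :=
        Nat.choose_symm_of_eq_add (by omega)
      rw [Nat.cast_one, chebV_one, show X ^ n * (X - 3 : ℤ[X]) = X ^ (n + 1) - (3 : ℤ) • X ^ n by
        rw [zsmul_eq_mul]; push_cast; ring, map_sub, map_smul, binomialFunctional_X_pow,
        binomialFunctional_X_pow, smul_eq_mul, h3, show 2 * (n + 1) + 1 = 2 * n + 1 + 1 + 1 by ring,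
        Nat.choose_succ_succ' _ (n + 1), Nat.choose_succ_succ' _ n, Nat.choose_succ_succ' _ (n + 1), h2]
      push_cast
      ring) n m
  simpa using h

end Moments

/-! ### Evaluation of the Hankel determinants. -/

section HankelDeterminants
open Polynomial

theorem hankelDet_odd_eq (k N : ℕ) :
    hankelDet (2 * k + 1) N = (modDivMatrix k (chebV k) fun a : Fin k ⊕ Fin k =>
      chebV ((N + (finSumFinEquiv a : Fin (k + k)) : ℕ) : ℤ)).det := by
  have h := det_functional_eq_modDivMatrix (binomialFunctional 1) (fun m => chebV m) (fun _ => 1)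
    (fun m => (monic_chebV m).1) (fun m => (monic_chebV m).2)
    (fun i m him => by
      rw [binomialFunctional_one_chebV, Nat.choose_eq_zero_of_lt (by omega), Nat.cast_zero])
    (fun m => by
      rw [binomialFunctional_one_chebV, show m + 1 + m = 2 * m + 1 by ring, Nat.choose_self,
        Nat.cast_one])
    (fun _ => one_ne_zero) (N := N) (chebV k) (monic_chebV k).2 (monic_chebV k).1
  rw [Finset.prod_const_one, one_mul] at h
  rw [← h, hankelDet]
  congr 1
  ext i j
  simp only [Matrix.of_apply]
  rw [← mul_assoc, ← pow_add, binomialFunctional_one_chebV]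
  congr 1
  rw [show 2 * (i + j + k : ℕ) + 1 = 2 * (i : ℕ) + 2 * j + (2 * k + 1) by ring]
  exact Nat.choose_symm_of_eq_add (by omega)

/-- The Chebyshev polynomials `chebC`, with the monic polynomial `1` in degree zero. -/
noncomputable def monicChebC (m : ℕ) : ℤ[X] := if m = 0 then 1 else chebC m

theorem monic_monicChebC (m : ℕ) : (monicChebC m).Monic := by
  rw [monicChebC]
  split_ifs with hm
  · exact monic_one
  · exact (monic_chebC (Nat.pos_of_ne_zero hm)).1

theorem natDegree_monicChebC (m : ℕ) : (monicChebC m).natDegree = m := by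
  rw [monicChebC]
  split_ifs with hm
  · rw [natDegree_one, hm]
  · exact (monic_chebC (Nat.pos_of_ne_zero hm)).2

theorem chebC_eq_mul_monicChebC (m : ℕ) :
    chebC m = C (if m = 0 then 2 else 1) * monicChebC m := by
  rw [monicChebC]
  split_ifs with hm
  · rw [hm, Nat.cast_zero, chebC_zero, mul_one]; rfl
  · simp

/-- The scalar 2 in the moments contributes 2^N, the norms only 2^(N-1) because the monic polynomial
1 has norm 1; hence the surviving factor 2. Positivity of N also keeps C_0 = 2, which is not monic,
out of the rows. -/
theorem two_mul_hankelDet_even_eq {k N : ℕ} (hk : 0 < k) (hN : 0 < N) :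
    2 * hankelDet (2 * k) N = (modDivMatrix k (chebC k) fun a : Fin k ⊕ Fin k =>
      chebC ((N + (finSumFinEquiv a : Fin (k + k)) : ℕ) : ℤ)).det := by
  obtain ⟨N, rfl⟩ := Nat.exists_eq_succ_of_ne_zero hN.ne'
  have h := det_functional_eq_modDivMatrix (binomialFunctional 0)
    monicChebC (fun m => if m = 0 then 1 else 2) monic_monicChebC natDegree_monicChebC
    (fun i m him => by
      rw [monicChebC, if_neg (by omega), binomialFunctional_zero_chebC, Nat.choose_eq_zero_of_lt (by omega)]
      simp)
    (fun m => by
      rw [monicChebC]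
      split_ifs with hm
      · simpa [hm] using binomialFunctional_X_pow 0 0
      · rw [binomialFunctional_zero_chebC, ← two_mul, Nat.choose_self]
        simp)
    (fun m => by split_ifs <;> norm_num) (N := N + 1) (chebC k) (monic_chebC hk).2
    (monic_chebC hk).1
  have hmat : (Matrix.of fun i j : Fin (N + 1) =>
      binomialFunctional 0 (X ^ ((i : ℕ) + j) * (X ^ k * chebC k))) =
      (2 : ℤ) • (Matrix.of fun i j : Fin (N + 1) =>
        ((Nat.choose (2 * (i : ℕ) + 2 * (j : ℕ) + 2 * k) ((i : ℕ) + (j : ℕ)) : ℕ) : ℤ)) := by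
    ext i j
    simp only [Matrix.of_apply, Matrix.smul_apply, smul_eq_mul]
    rw [← mul_assoc, ← pow_add, binomialFunctional_zero_chebC]
    congr 2
    rw [show 2 * (i + j + k : ℕ) = 2 * (i : ℕ) + 2 * j + 2 * k by ring]
    exact Nat.choose_symm_of_eq_add (by omega)
  rw [hmat, Matrix.det_smul, Fintype.card_fin, Fin.prod_univ_succ] at h
  simp only [Fin.val_zero, if_true, Fin.val_succ, Nat.add_eq_zero_iff, one_ne_zero, and_false,
    if_false, Finset.prod_const, Finset.card_univ, Fintype.card_fin, one_mul] at h
  refine mul_left_cancel₀ (pow_ne_zero N (two_ne_zero (α := ℤ))) ?_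
  rw [hankelDet, ← mul_assoc, ← pow_succ, h]
  congr 3
  ext a : 1
  rw [monicChebC, if_neg (by omega)]

theorem prod_ite_zero_mul {k : ℕ} (hk : 0 < k) (a b : ℤ) :
    ∏ j : Fin k, (if (j : ℕ) = 0 then a * b else b) = a * b ^ k := by
  obtain ⟨k, rfl⟩ := Nat.exists_eq_succ_of_ne_zero hk.ne'
  rw [Fin.prod_univ_succ]
  simp [pow_succ']
  ring

theorem hankelDet_odd (k n : ℕ) :
    hankelDet (2 * k + 1) ((2 * k + 1) * n + 1) = (2 * (n : ℤ) + 1) ^ k := by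
  rw [hankelDet_odd_eq]
  rcases Nat.eq_zero_or_pos k with rfl | hk
  · simp
  have hdvd := chebV_dvd_chebV_add_sub k
  obtain ⟨G, hG⟩ : chebV k ∣ chebV ((2 * k + 1) * n + k) :=
    (dvd_sub_left (Dvd.intro_left _ rfl)).mp (hdvd n k)
  -- At X = 0, use 2((2k+1)n + k) + 1 = (2k+1)(2n+1).
  have hG0 : G.coeff 0 = (-1) ^ n * (2 * n + 1) := by
    have h1 := congrArg (fun f => coeff f 0) hG
    have h2 := coeff_zero_chebV ((2 * k + 1) * n + k)
    push_cast at h2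
    simp only [mul_coeff_zero, coeff_zero_chebV, h2] at h1
    have h3 : ((-1) ^ k * (2 * k + 1) : ℤ) ≠ 0 :=
      mul_ne_zero (pow_ne_zero _ (by norm_num)) (by positivity)
    refine mul_left_cancel₀ h3 ?_
    rw [← h1, pow_add, pow_mul, Odd.neg_one_pow ⟨k, rfl⟩]
    ring
  rw [det_modDivMatrix_center_add hk (chebV k) G (monic_chebV k).1 (monic_chebV k).2
    (fun m => chebV m) monicChebC
    (fun j => chebV (((2 * k + 1) * n + 1 + j : ℕ) : ℤ)) (fun m => (monic_chebV m).1)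
    (fun m => (monic_chebV m).2) monic_monicChebC natDegree_monicChebC
    (fun j => if j = 0 then -1 * (-1) ^ n else (-1) ^ n), prod_ite_zero_mul hk, hG0, mul_pow]
  · have hsq : (((-1) ^ n) ^ k * ((-1) ^ n) ^ k : ℤ) = 1 := by
      rw [← mul_pow, ← mul_pow]; simp
    linear_combination (2 * (n : ℤ) + 1) ^ k * hsq
  -- The unpaired row has index -1 after n+1 antiperiods, and V_(-1) = V_0; this explains the extra
  -- sign at j = 0.
  · have h := hdvd (n + 1) (-1)
    rw [chebV_neg_one, ← chebV_zero] at h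
    rw [if_pos rfl, show (((2 * k + 1) * n + 1 + (k + k - 1) : ℕ) : ℤ) =
      (2 * k + 1) * (n + 1 : ℕ) + -1 by push_cast [show 1 ≤ k + k by omega]; ring]
    rwa [pow_succ'] at h
  · intro j hj0 hjk
    have h := hdvd n j
    rw [if_neg hj0.ne', show (((2 * k + 1) * n + 1 + (j - 1) : ℕ) : ℤ) =
      (2 * k + 1) * n + j by push_cast [show 1 ≤ j by omega]; ring]
    exact h
  · rw [← hG]
    congr 1
    push_cast [show 1 ≤ k by omega]
    ring
  · intro s hs0 hsk
    have h := add_add_sub_of_recurrence chebV_add_one ((2 * k + 1) * n + k) s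
    rw [hG, chebC_eq_mul_monicChebC, if_neg hs0.ne', C_1, one_mul] at h
    rw [show (((2 * k + 1) * n + 1 + (k - 1 + s) : ℕ) : ℤ) = (2 * k + 1) * n + k + s by
        push_cast [show 1 ≤ k by omega]; ring,
      show (((2 * k + 1) * n + 1 + (k - 1 - s) : ℕ) : ℤ) = (2 * k + 1) * n + k - s by
        push_cast [show 1 ≤ k by omega, show s ≤ k - 1 by omega]; ring, h]
    ring

theorem hankelDet_even (k n : ℕ) :
    hankelDet (2 * k) (2 * k * n + 1) = (-1) ^ (k * n) := by
  rcases Nat.eq_zero_or_pos k with rfl | hk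
  · rw [show 2 * 0 * n + 1 = 1 by ring]
    simp [hankelDet]
  refine mul_left_cancel₀ (two_ne_zero (α := ℤ)) ?_
  rw [two_mul_hankelDet_even_eq hk (Nat.succ_pos _)]
  have hdvd := chebC_dvd_chebC_add_sub k
  obtain ⟨G, hG⟩ : chebC k ∣ chebC (2 * k * n + k) :=
    (dvd_sub_left (Dvd.intro_left _ rfl)).mp (hdvd n k)
  have hG0 : G.coeff 0 = 1 := by
    have h1 := congrArg (fun f => coeff f 0) hG
    have h2 := coeff_zero_chebC (2 * k * n + k)
    push_cast at h2
    simp only [mul_coeff_zero, coeff_zero_chebC, h2] at h1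
    have h3 : (2 * (-1) ^ k : ℤ) ≠ 0 := mul_ne_zero two_ne_zero (pow_ne_zero _ (by norm_num))
    refine mul_left_cancel₀ h3 ?_
    rw [← h1, pow_add, mul_assoc 2 k n, pow_mul]
    simp
  rw [det_modDivMatrix_center_add hk (chebC k) G (monic_chebC hk).1 (monic_chebC hk).2
    monicChebC monicChebC
    (fun j => chebC ((2 * k * n + 1 + j : ℕ) : ℤ)) monic_monicChebC natDegree_monicChebC
    monic_monicChebC natDegree_monicChebC
    (fun j => if j = 0 then -2 * (-1) ^ n else (-1) ^ n), prod_ite_zero_mul hk, hG0]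
  · rw [mul_comm k n, pow_mul]
    ring
  -- The unpaired row lies n+1 antiperiods above C_0 = 2, hence the scalar -2(-1)^n; its 2 matches
  -- the factor on the left.
  · have h := hdvd (n + 1) 0
    rw [if_pos rfl, show ((2 * k * n + 1 + (k + k - 1) : ℕ) : ℤ) =
      2 * k * (n + 1 : ℕ) + 0 by push_cast [show 1 ≤ k + k by omega]; ring]
    rw [← Nat.cast_zero, chebC_eq_mul_monicChebC 0, if_pos rfl, ← mul_assoc, ← C_mul,
      pow_succ'] at h
    rwa [show (-2 * (-1) ^ n : ℤ) = -1 * (-1) ^ n * 2 by ring]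
  · intro j hj0 hjk
    have h := hdvd n j
    rw [if_neg hj0.ne', show ((2 * k * n + 1 + (j - 1) : ℕ) : ℤ) =
      2 * k * n + j by push_cast [show 1 ≤ j by omega]; ring]
    rwa [chebC_eq_mul_monicChebC j, if_neg hj0.ne', C_1, one_mul] at h
  · rw [← hG]
    congr 1
    push_cast [show 1 ≤ k by omega]
    ring
  · intro s hs0 hsk
    have h := add_add_sub_of_recurrence chebC_add_one (2 * k * n + k) s
    rw [hG, chebC_eq_mul_monicChebC s, if_neg hs0.ne', C_1, one_mul] at h
    rw [show ((2 * k * n + 1 + (k - 1 + s) : ℕ) : ℤ) = 2 * k * n + k + s by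
        push_cast [show 1 ≤ k by omega]; ring,
      show ((2 * k * n + 1 + (k - 1 - s) : ℕ) : ℤ) = 2 * k * n + k - s by
        push_cast [show 1 ≤ k by omega, show s ≤ k - 1 by omega]; ring, h]
    ring

theorem hankelDet_even_add (k n : ℕ) (hk : 1 ≤ k) :
    hankelDet (2 * k) (2 * k * n + k + 1) =
      -((-1 : ℤ) ^ (k * n + Nat.choose k 2) *
        (4 ^ (k - 1) * (k : ℤ) ^ (k - 1) * ((n : ℤ) + 1) ^ (k - 1))) := by
  refine mul_left_cancel₀ (two_ne_zero (α := ℤ)) ?_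
  rw [two_mul_hankelDet_even_eq hk (Nat.succ_pos _)]
  have hdvd := chebC_dvd_chebC_add_sub k
  have hne : (2 * (-1) ^ k : ℤ) ≠ 0 := mul_ne_zero two_ne_zero (pow_ne_zero _ (by norm_num))
  obtain ⟨G, hG⟩ : chebC k ∣ chebC (2 * k * (n + 1 : ℕ) + k) :=
    (dvd_sub_left (Dvd.intro_left _ rfl)).mp (hdvd (n + 1) k)
  have hG0 : G.coeff 0 = 1 := by
    have h1 := congrArg (fun f => coeff f 0) hG
    have h2 := coeff_zero_chebC (2 * k * (n + 1) + k)
    push_cast at h1 h2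
    simp only [mul_coeff_zero, coeff_zero_chebC, h2] at h1
    refine mul_left_cancel₀ hne ?_
    rw [← h1, pow_add, mul_assoc 2 k (n + 1), pow_mul]
    simp
  -- The centre is 2k(n+1), so mirror differences contain S_(2k(n+1)-1) = C_k K. The cofactor (X-4)K
  -- is the source of 4k(n+1).
  obtain ⟨K, hK⟩ := chebC_dvd_chebS k (n + 1)
  have hK0 : K.coeff 0 = -((-1) ^ k * (k * (n + 1))) := by
    have h1 := congrArg (fun f => coeff f 0) hK
    have h2 := coeff_zero_chebS (2 * k * (n + 1) - 1)
    have hpos : 1 ≤ 2 * k * (n + 1) := Nat.mul_pos (by omega) (by omega)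
    have hodd : Odd (2 * k * (n + 1) - 1) := Nat.Even.sub_odd hpos ⟨k * (n + 1), by ring⟩ odd_one
    rw [hodd.neg_one_pow] at h2
    push_cast [hpos] at h1 h2
    simp only [mul_coeff_zero, coeff_zero_chebC, h2] at h1
    refine mul_left_cancel₀ hne ?_
    rw [← h1]
    have h3 : ((-1) ^ k * (-1) ^ k : ℤ) = 1 := by rw [← mul_pow]; simp
    linear_combination (2 * k * (n + 1) : ℤ) * h3
  rw [det_modDivMatrix_center_sub hk (chebC k) G ((X - 4) * K) (monic_chebC hk).1
    (monic_chebC hk).2 monicChebC (fun m => chebS m)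
    (fun j => chebC ((2 * k * n + k + 1 + j : ℕ) : ℤ)) monic_monicChebC natDegree_monicChebC
    (fun m => (monic_chebS m).1) (fun m => (monic_chebS m).2)
    (fun j => if j = 0 then 2 * (-1) ^ (n + 1) else (-1) ^ (n + 1)), prod_ite_zero_mul hk, hG0]
  · have hH0 : ((X - 4) * K).coeff 0 = (-1 : ℤ) ^ k * (4 * k * (n + 1)) := by
      rw [mul_coeff_zero, hK0, coeff_sub, coeff_X_zero, show (4 : ℤ[X]) = C 4 from rfl, coeff_C_zero]
      ring
    obtain ⟨k, rfl⟩ := Nat.exists_eq_succ_of_ne_zero (Nat.pos_iff_ne_zero.mp hk)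
    have hev : (((-1) ^ (k + 1)) ^ k : ℤ) = 1 := by
      rw [← pow_mul, mul_comm]; exact (Nat.even_mul_succ_self k).neg_one_pow
    have hsign : ((-1) ^ k * ((-1) ^ (n + 1)) ^ (k + 1) : ℤ) = -(-1) ^ ((k + 1) * n) := by
      have hsq : ((-1) ^ k * (-1) ^ k : ℤ) = 1 := by rw [← mul_pow]; simp
      rw [pow_succ (-1 : ℤ) n, mul_pow, ← pow_mul, mul_comm n, pow_succ (-1 : ℤ) k]
      linear_combination -(-1) ^ ((k + 1) * n) * hsq
    rw [hH0, Nat.succ_eq_add_one, Nat.add_sub_cancel, mul_pow, hev, mul_pow, mul_pow,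
      pow_add (-1 : ℤ) (Nat.choose _ _), pow_add (-1 : ℤ) ((k + 1) * n)]
    linear_combination 2 * (-1) ^ (k + 1).choose 2 *
      (4 ^ k * ((k + 1 : ℕ) : ℤ) ^ k * ((n : ℤ) + 1) ^ k) * hsign
  · intro j hj
    have h := hdvd (n + 1) (-j)
    rw [chebC_neg, chebC_eq_mul_monicChebC j, ← mul_assoc, ← C_mul] at h
    rw [show ((2 * k * n + k + 1 + (k - 1 - j) : ℕ) : ℤ) = 2 * k * (n + 1 : ℕ) + -j by
      push_cast [hk, show j ≤ k - 1 by omega]; ring]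
    convert h using 4
    split_ifs <;> ring
  · rw [← hG]
    congr 1
    push_cast [show 1 ≤ k + k by omega]
    ring
  · intro s hs
    have h := chebC_add_sub_chebC_sub (2 * k * (n + 1 : ℕ)) (s + 1)
    rw [hK, add_sub_cancel_right] at h
    rw [show ((2 * k * n + k + 1 + (k + s) : ℕ) : ℤ) = 2 * k * (n + 1 : ℕ) + (s + 1) by
        push_cast; ring,
      show ((2 * k * n + k + 1 + (k - 2 - s) : ℕ) : ℤ) = 2 * k * (n + 1 : ℕ) - (s + 1) by
        push_cast [show 2 ≤ k by omega, show s ≤ k - 2 by omega]; ring, h]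
    ring

end HankelDeterminants

theorem mainTheorem2 :
    (∀ k n : ℕ, hankelDet (2 * k + 1) ((2 * k + 1) * n + 1) = (2 * (n : ℤ) + 1) ^ k) ∧
    (∀ k n : ℕ, hankelDet (2 * k) (2 * k * n + 1) = (-1 : ℤ) ^ (k * n)) ∧
    (∀ k n : ℕ, 1 ≤ k →
      hankelDet (2 * k) (2 * k * n + k + 1) =
        -((-1 : ℤ) ^ (k * n + Nat.choose k 2) *
          (4 ^ (k - 1) * (k : ℤ) ^ (k - 1) * ((n : ℤ) + 1) ^ (k - 1)))) :=
  ⟨hankelDet_odd, hankelDet_even, hankelDet_even_add⟩
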